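/- A Dyck word of length $N$ ($N$ even) is a word $\sigma=\sigma(1)\cdots\sigma(N)$ over the symbols $+$ (opening bracket) and $-$ (closing bracket) with as many $+$ as $-$, in which no prefix contains more $-$ than $+$. Let $$Z(1)={+}{-},\qquad Z(n+1)={+}\,Z(n)\,Z(n)\,{-}\quad(n\ge 1).$$ A re-pairing of $\sigma$ is a sequence of pairs $p=(p_1,\dots,p_{N/2})$, $p_i=(\ell_i,r_i)$, such that $\sigma(\ell_i)=+$, $\sigma(r_i)=-$ and $\ell_i<r_i$ for all $i$, and every number in $\{1,\dots,N\}$ occurs in exactly one pair. For $0\le t\le N/2$ put $B_t(p)=\{\ell_i,r_i : i\le t\}$. The width of a finite set $S$ of integers is the smallest number of integer intervals $[a,b]=\{x\in\mathbb Z: a\le x\le b\}$ whose union is $S$. The width of $p$ is the maximum over $t$ of the width of $B_t(p)$, and $\operatorname{width}(\sigma)$ is the minimum of the widths of the re-pairings of $\sigma$. Theorem. $\operatorname{width}(Z(n))=2^{O(\sqrt{\log n})}$; that is, there is a constant $C$ such that for all integers $n\ge 2$, $$\operatorname{width}(Z(n))\le 2^{\,C\sqrt{\log_2 n}}.$$ 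-/

import Mathlib

namespace BracketRepairing

/-- The words `Z(n)`: `Z(n+1) = + Z(n) Z(n) -`, starting from the empty word `Z(0)`,
so that `Z(1) = + -`. Here `+` is `DyckStep.U`, `-` is `DyckStep.D`, the sum of Dyck words
is concatenation and `nest` encloses a word in one pair of brackets. -/
def Z : ℕ → DyckWord
  | 0 => 0
  | n + 1 => (Z n + Z n).nest

/-- `p = (p₁, …, p_{N/2})`, a sequence of pairs `(ℓ, r)` of positions, is a re-pairing of the
Dyck word `σ` of length `N`. Positions are numbered `0, …, N - 1`. -/
structure IsRepairing (σ : DyckWord) (p : List (ℕ × ℕ)) : Prop where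
  /-- there are `N / 2` pairs -/
  two_mul_length : 2 * p.length = σ.toList.length
  /-- the first position of each pair carries a plus -/
  plus : ∀ x ∈ p, σ.toList[x.1]? = some DyckStep.U
  /-- the second position of each pair carries a minus -/
  minus : ∀ x ∈ p, σ.toList[x.2]? = some DyckStep.D
  /-- the plus precedes the minus -/
  lt : ∀ x ∈ p, x.1 < x.2
  /-- every position occurs in exactly one pair -/
  cover : ∀ b < σ.toList.length, ∃! i : Fin p.length, b = (p.get i).1 ∨ b = (p.get i).2

/-- The set `B_t(p)` of the positions erased by the first `t` pairs of `p`. -/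
def erased (p : List (ℕ × ℕ)) (t : ℕ) : Set ℕ :=
  {b | ∃ x ∈ p.take t, b = x.1 ∨ b = x.2}

/-- The width of a (finite) set `S` of integers: the smallest number of intervals `[a, b]`
whose union is `S`. -/
noncomputable def setWidth (S : Set ℕ) : ℕ :=
  sInf {m : ℕ | ∃ a b : Fin m → ℕ, S = ⋃ i, Set.Icc (a i) (b i)}

/-- The width of a sequence of pairs: the maximum over time `t` of the width of the set of the
positions erased up to time `t`. (The time `t = 0` contributes the width `0` of `∅`.) -/
noncomputable def repairingWidth (p : List (ℕ × ℕ)) : ℕ :=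
  (Finset.range (p.length + 1)).sup fun t => setWidth (erased p t)

/-- The width of a Dyck word: the minimum width of its re-pairings. -/
noncomputable def width (σ : DyckWord) : ℕ :=
  sInf {w : ℕ | ∃ p : List (ℕ × ℕ), IsRepairing σ p ∧ repairingWidth p = w}

end BracketRepairing

/-!
Read the word from left to right, keeping the positions of the unpaired pluses as a list `B ++ A`
and pairing each minus with the first element of `A`, the stack, while the base `B` is left alone.
The erased positions are the complement of `B ++ A` in the part read so far, so it suffices that
`B ++ A` consists of few runs of consecutive integers.

The stack is kept superincreasing, i.e. composed of intervals each of which is at least as long as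
all the previous ones together, so that it has at most `log₂ |A| + 1` runs. Then `Z D` can be read
on top of it so that the stack is afterwards unchanged or replaced by one interval of the same
length. If `D < |A|`, move the stack to the base: this adds at most `log₂ |A| + 1` runs to the base,
while `|A| + D` drops to `D`, which is less than half of it. If `s = |A| ≤ D`, then
`Z D = +ˢ Z(D-s) · Z(D-s) - · Z(D-s+1) - ⋯ Z(D-1) -`: push the `s` pluses onto the stack, which
stays superincreasing, and read the factors one by one; the `s` minuses consume the old stack.
The halving happens at most `log₂ n` times, so `O(log² n)` runs suffice in total.
-/

namespace BracketRepairing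

open Finset
open scoped List

/-! ### Runs of consecutive integers -/

theorem setWidth_biUnion_Icc_le {ι : Type*} (T : Finset ι) (a b : ι → ℕ) :
    setWidth (⋃ i ∈ T, Set.Icc (a i) (b i)) ≤ #T := by
  refine Nat.sInf_le ⟨fun j => a (T.equivFin.symm j), fun j => b (T.equivFin.symm j), ?_⟩
  rw [T.equivFin.symm.surjective.iUnion_comp (fun i : T => Set.Icc (a i) (b i)), Set.iUnion_subtype]

theorem setWidth_coe_le_card_leftEnds (F : Finset ℕ) :
    setWidth F ≤ #{a ∈ F | a = 0 ∨ a - 1 ∉ F} := by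
  classical
  let rightEnd (a : ℕ) : ℕ := Nat.findGreatest (fun b => Set.Icc a b ⊆ F) (F.sup id)
  convert setWidth_biUnion_Icc_le {a ∈ F | a = 0 ∨ a - 1 ∉ F} id rightEnd using 2
  refine subset_antisymm (fun x hx => ?_) (Set.iUnion₂_subset fun a ha => ?_)
  · have hex : ∃ a, Set.Icc a x ⊆ F := ⟨x, by simpa using hx⟩
    have hle : Nat.find hex ≤ x := Nat.find_min' hex (by simpa using hx)
    have hsub : Set.Icc (Nat.find hex) x ⊆ F := Nat.find_spec hex
    have hleft : Nat.find hex = 0 ∨ Nat.find hex - 1 ∉ F := by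
      by_contra! ⟨hne, hmem⟩
      refine Nat.find_min hex (Nat.sub_one_lt hne) fun y hy => ?_
      obtain rfl | hlt := hy.1.eq_or_lt
      · exact hmem
      · exact hsub ⟨by omega, hy.2⟩
    exact Set.mem_biUnion (mem_coe.2 (mem_filter.2 ⟨hsub ⟨le_rfl, hle⟩, hleft⟩))
      ⟨hle, Nat.le_findGreatest (le_sup (f := id) hx) hsub⟩
  · have haF : a ∈ F := (mem_filter.1 ha).1
    exact Nat.findGreatest_spec (P := fun b => Set.Icc a b ⊆ F) (le_sup (f := id) haF)
      (by simpa using haF)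

/-- The number of maximal runs of consecutive integers in a list, counted by their last elements;
the order of the list is irrelevant. It bounds the widths that arise during a re-pairing. -/
def runs (l : List ℕ) : ℕ := #{x ∈ l.toFinset | x + 1 ∉ l}

theorem runs_nil : runs [] = 0 := rfl

theorem runs_append_le (l m : List ℕ) : runs (l ++ m) ≤ runs l + runs m := by
  refine (card_le_card fun x => ?_).trans (card_union_le _ _)
  simp only [mem_filter, List.mem_toFinset, List.mem_append, mem_union]
  tauto

theorem runs_range'_le (a m : ℕ) : runs (List.range' a m) ≤ 1 := by
  refine (card_le_card (t := {a + m - 1}) fun x => ?_).trans (card_singleton _).le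
  simp only [mem_filter, List.mem_toFinset, List.mem_range'_1, mem_singleton]
  omega

theorem setWidth_compl_le (q : ℕ) (l : List ℕ) :
    setWidth {b | b < q ∧ b ∉ l} ≤ runs l + 1 := by
  set F : Finset ℕ := {b ∈ range q | b ∉ l} with hF
  have hcoe : {b | b < q ∧ b ∉ l} = (F : Set ℕ) := by simp [hF]
  have hleft : {a ∈ F | a = 0 ∨ a - 1 ∉ F} ⊆
      insert 0 ({x ∈ l.toFinset | x + 1 ∉ l}.image (· + 1)) := by
    rintro (_ | a) ha
    · exact mem_insert_self _ _
    · simp only [hF, mem_filter, mem_range, Nat.add_sub_cancel] at ha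
      refine mem_insert_of_mem (mem_image_of_mem _ (mem_filter.2 ⟨List.mem_toFinset.2 ?_, ha.1.2⟩))
      grind
  rw [hcoe]
  calc setWidth F ≤ #{a ∈ F | a = 0 ∨ a - 1 ∉ F} := setWidth_coe_le_card_leftEnds F
    _ ≤ #(insert 0 ({x ∈ l.toFinset | x + 1 ∉ l}.image (· + 1))) := card_le_card hleft
    _ ≤ runs l + 1 := (card_insert_le _ _).trans (Nat.succ_le_succ card_image_le)

/-! ### Partial re-pairings -/

/-- The list of all positions occurring in a sequence of pairs. -/
def positions (p : List (ℕ × ℕ)) : List ℕ := p.flatMap fun x => [x.1, x.2]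

theorem length_positions (p : List (ℕ × ℕ)) : (positions p).length = 2 * p.length := by
  simp [positions, mul_comm]

theorem mem_positions {p : List (ℕ × ℕ)} {b : ℕ} :
    b ∈ positions p ↔ ∃ x ∈ p, b = x.1 ∨ b = x.2 := by
  simp [positions]

theorem repairingWidth_concat_le (p : List (ℕ × ℕ)) (x : ℕ × ℕ) :
    repairingWidth (p ++ [x]) ≤
      max (repairingWidth p) (setWidth {b | b ∈ positions (p ++ [x])}) := by
  refine Finset.sup_le fun t _ => ?_
  obtain hle | hlt := le_or_gt t p.length
  · refine le_max_of_le_left ?_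
    rw [erased, List.take_append_of_le_length hle]
    exact le_sup (f := fun t => setWidth (erased p t)) (mem_range.2 (Nat.lt_succ_of_le hle))
  · refine le_max_of_le_right (le_of_eq ?_)
    rw [erased, List.take_of_length_le (by simpa using hlt)]
    simp only [mem_positions]

/-- The pairs `p` match pluses with later minuses of the word `w`, and the positions of `w` they do
not use are those in the list `S`, each of which carries a plus. -/
structure PartialRepairing (w : List DyckStep) (S : List ℕ) (p : List (ℕ × ℕ)) : Prop where
  plus : ∀ x ∈ p, w[x.1]? = some DyckStep.U
  minus : ∀ x ∈ p, w[x.2]? = some DyckStep.D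
  lt : ∀ x ∈ p, x.1 < x.2
  unpaired_plus : ∀ b ∈ S, w[b]? = some DyckStep.U
  perm : positions p ++ S ~ List.range w.length

theorem getElem?_append_of_eq_some {α : Type*} {w : List α} {i : ℕ} {a : α}
    (h : w[i]? = some a) (v : List α) : (w ++ v)[i]? = some a := by
  rwa [List.getElem?_append_left (List.getElem?_eq_some_iff.1 h).1]

namespace PartialRepairing

variable {w : List DyckStep} {S : List ℕ} {p : List (ℕ × ℕ)}

theorem nil : PartialRepairing [] [] [] := by
  constructor <;> simp [positions]

theorem lt_length (h : PartialRepairing w S p) {b : ℕ} (hb : b ∈ S) : b < w.length :=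
  (List.getElem?_eq_some_iff.1 (h.unpaired_plus b hb)).1

theorem nodup (h : PartialRepairing w S p) : (positions p ++ S).Nodup :=
  h.perm.nodup_iff.2 List.nodup_range

theorem mem_positions_iff (h : PartialRepairing w S p) {b : ℕ} :
    b ∈ positions p ↔ b < w.length ∧ b ∉ S := by
  have hmem : b ∈ positions p ∨ b ∈ S ↔ b < w.length := by
    rw [← List.mem_append, h.perm.mem_iff, List.mem_range]
  have hdisj : b ∈ positions p → b ∉ S := fun hb => (List.nodup_append'.1 h.nodup).2.2 hb
  tauto

theorem push (h : PartialRepairing w S p) :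
    PartialRepairing (w ++ [DyckStep.U]) (S ++ [w.length]) p where
  plus x hx := getElem?_append_of_eq_some (h.plus x hx) _
  minus x hx := getElem?_append_of_eq_some (h.minus x hx) _
  lt := h.lt
  unpaired_plus := List.forall_mem_append.2
    ⟨fun b hb => getElem?_append_of_eq_some (h.unpaired_plus b hb) _, by simp⟩
  perm := by
    rw [← List.append_assoc, List.length_append, List.length_singleton, List.range_succ]
    exact h.perm.append_right _

theorem pop {x : ℕ} {S' : List ℕ} (h : PartialRepairing w S p) (hS : S ~ x :: S') :
    PartialRepairing (w ++ [DyckStep.D]) S' (p ++ [(x, w.length)]) where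
  plus := List.forall_mem_append.2
    ⟨fun y hy => getElem?_append_of_eq_some (h.plus y hy) _, List.forall_mem_singleton.2 <|
      getElem?_append_of_eq_some (h.unpaired_plus x (hS.mem_iff.2 List.mem_cons_self)) _⟩
  minus := List.forall_mem_append.2
    ⟨fun y hy => getElem?_append_of_eq_some (h.minus y hy) _, by simp⟩
  lt := List.forall_mem_append.2
    ⟨h.lt, List.forall_mem_singleton.2 (h.lt_length (hS.mem_iff.2 List.mem_cons_self))⟩
  unpaired_plus b hb := getElem?_append_of_eq_some
    (h.unpaired_plus b (hS.mem_iff.2 (List.mem_cons_of_mem x hb))) _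
  perm := by
    rw [List.length_append, List.length_singleton, List.range_succ]
    calc positions (p ++ [(x, w.length)]) ++ S'
        = positions p ++ ([x] ++ ([w.length] ++ S')) := by simp [positions]
      _ ~ positions p ++ ([x] ++ (S' ++ [w.length])) :=
          (List.perm_append_comm.append_left _).append_left _
      _ = positions p ++ (x :: S') ++ [w.length] := by simp
      _ ~ positions p ++ S ++ [w.length] := (hS.symm.append_left _).append_right _
      _ ~ List.range w.length ++ [w.length] := h.perm.append_right _

theorem isRepairing {σ : DyckWord} (h : PartialRepairing σ.toList [] p) : IsRepairing σ p where
  two_mul_length := by simpa [length_positions] using h.perm.length_eq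
  plus := h.plus
  minus := h.minus
  lt := h.lt
  cover b hb := by
    obtain ⟨x, hx, hbx⟩ := mem_positions.1 (h.mem_positions_iff.2 ⟨hb, List.not_mem_nil⟩)
    obtain ⟨i, rfl⟩ := List.mem_iff_get.1 hx
    have hdisj : p.Pairwise (Function.onFun List.Disjoint fun x => [x.1, x.2]) :=
      (List.nodup_flatMap.1 (List.nodup_append'.1 h.nodup).1).2
    have hne : ∀ i j, i < j → (b = (p.get i).1 ∨ b = (p.get i).2) →
        ¬ (b = (p.get j).1 ∨ b = (p.get j).2) := fun i j hij hi hj =>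
      List.pairwise_iff_get.1 hdisj i j hij (by simpa using hi) (by simpa using hj)
    refine ⟨i, hbx, fun j hbj => ?_⟩
    obtain hij | hij | hij := lt_trichotomy i j
    · exact absurd hbj (hne i j hij hbx)
    · exact hij.symm
    · exact absurd hbx (hne j i hij hbj)

end PartialRepairing

/-- Reading the word `w`, one can erase all of it except for the pluses at the positions in `S`
while keeping the width at most `k`. -/
def Reachable (k : ℕ) (w : List DyckStep) (S : List ℕ) : Prop :=
  ∃ p, PartialRepairing w S p ∧ repairingWidth p ≤ k

namespace Reachable

variable {k : ℕ} {w : List DyckStep} {S B A : List ℕ}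

theorem nil (k : ℕ) : Reachable k [] [] := by
  have hempty : setWidth ∅ = 0 := by
    simpa using setWidth_biUnion_Icc_le (∅ : Finset ℕ) id id
  exact ⟨[], .nil, Finset.sup_le fun t _ => by simp [erased, hempty]⟩

theorem width_le {σ : DyckWord} (h : Reachable k σ.toList []) : width σ ≤ k := by
  obtain ⟨p, hp, hk⟩ := h
  exact (Nat.sInf_le ⟨p, hp.isRepairing, rfl⟩ : width σ ≤ repairingWidth p).trans hk

theorem push_replicate (h : Reachable k w S) (s : ℕ) :
    Reachable k (w ++ List.replicate s DyckStep.U) (S ++ List.range' w.length s) := by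
  induction s with
  | zero => simpa using h
  | succ s ih =>
    obtain ⟨p, hp, hk⟩ := ih
    exact ⟨p, by simpa [List.replicate_succ', List.range'_1_concat] using hp.push, hk⟩

theorem pop_head (h : Reachable k w (B ++ A)) (hA : A ≠ []) (hk : runs (B ++ A.tail) + 1 ≤ k) :
    Reachable k (w ++ [DyckStep.D]) (B ++ A.tail) := by
  obtain ⟨p, hp, hpk⟩ := h
  obtain ⟨x, A, rfl⟩ := List.exists_cons_of_ne_nil hA
  have hp' := hp.pop List.perm_middle
  have herased : setWidth {b | b ∈ positions (p ++ [(x, w.length)])} ≤ k := by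
    simp only [hp'.mem_positions_iff]
    exact (setWidth_compl_le _ _).trans hk
  exact ⟨_, hp', (repairingWidth_concat_le _ _).trans (max_le hpk herased)⟩

end Reachable

/-! ### Superincreasing stacks -/

/-- A list composed of intervals, each at least as long as all the previous ones together: the
shape in which the stack of unpaired pluses is kept. -/
inductive Superincreasing : List ℕ → Prop
  | nil : Superincreasing []
  | append {A : List ℕ} (a m : ℕ) (hA : Superincreasing A) (hm : A.length ≤ m) :
      Superincreasing (A ++ List.range' a m)

namespace Superincreasing

variable {A : List ℕ}

theorem range' (a m : ℕ) : Superincreasing (List.range' a m) := by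
  simpa using nil.append a m m.zero_le

theorem tail (h : Superincreasing A) : Superincreasing A.tail := by
  induction h with
  | nil => exact .nil
  | @append A a m _ hm ih =>
    obtain _ | ⟨x, A⟩ := A
    · rw [List.nil_append, List.tail_range']
      exact .range' _ _
    · exact ih.append a m ((Nat.le_succ _).trans hm)

theorem drop (h : Superincreasing A) (j : ℕ) : Superincreasing (A.drop j) := by
  induction j with
  | zero => exact h
  | succ j ih => exact List.tail_drop ▸ ih.tail

theorem runs_le (h : Superincreasing A) : runs A ≤ Nat.log 2 A.length + 1 := by
  induction h with
  | nil => exact Nat.zero_le _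
  | @append A a m _ hm ih =>
    have hI : runs (List.range' a m) ≤ 1 := runs_range'_le a m
    obtain rfl | hA := eq_or_ne A []
    · exact hI.trans (Nat.le_add_left _ _)
    rw [List.length_append, List.length_range']
    calc runs (A ++ List.range' a m)
        ≤ runs A + runs (List.range' a m) := runs_append_le _ _
      _ ≤ (Nat.log 2 A.length + 1) + 1 := Nat.add_le_add ih hI
      _ = Nat.log 2 (A.length * 2) + 1 := by
          rw [Nat.log_mul_base one_lt_two (List.length_pos_iff.2 hA).ne']
      _ ≤ Nat.log 2 (A.length + m) + 1 := by gcongr; omega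

theorem runs_append_le (h : Superincreasing A) (B : List ℕ) {N : ℕ} (hN : A.length ≤ N) :
    runs (B ++ A) ≤ runs B + (Nat.log 2 N + 1) :=
  (BracketRepairing.runs_append_le B A).trans <| Nat.add_le_add_left
    (h.runs_le.trans (Nat.succ_le_succ (Nat.log_mono_right hN))) _

end Superincreasing

/-- The stack `A'` is `A` itself or a single interval of the same length. -/
def Consolidates (A A' : List ℕ) : Prop := A' = A ∨ ∃ a, A' = List.range' a A.length

namespace Consolidates

variable {A A' A'' : List ℕ}

theorem refl (A : List ℕ) : Consolidates A A := .inl rfl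

theorem length_eq (h : Consolidates A A') : A'.length = A.length := by
  obtain rfl | ⟨a, rfl⟩ := h
  exacts [rfl, List.length_range']

theorem trans (h : Consolidates A A') (h' : Consolidates A' A'') : Consolidates A A'' := by
  obtain rfl | ⟨a, rfl⟩ := h'
  exacts [h, .inr ⟨a, by rw [h.length_eq]⟩]

theorem drop (h : Consolidates A A') (j : ℕ) : Consolidates (A.drop j) (A'.drop j) := by
  obtain rfl | ⟨a, rfl⟩ := h
  exacts [refl _, .inr ⟨a + j, by simp⟩]

theorem superincreasing (h : Consolidates A A') (hA : Superincreasing A) :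
    Superincreasing A' := by
  obtain rfl | ⟨a, rfl⟩ := h
  exacts [hA, .range' _ _]

theorem exists_eq_range' {a m : ℕ} (h : Consolidates (List.range' a m) A) :
    ∃ b, A = List.range' b m := by
  obtain rfl | ⟨b, rfl⟩ := h
  exacts [⟨a, rfl⟩, ⟨b, by rw [List.length_range']⟩]

end Consolidates

/-! ### Erasing `Z(D)` on top of a stack -/

theorem toList_Z_zero : (Z 0).toList = [] := rfl

theorem toList_Z_succ (n : ℕ) :
    (Z (n + 1)).toList = [DyckStep.U] ++ (Z n).toList ++ (Z n).toList ++ [DyckStep.D] :=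
  congrArg (· ++ [DyckStep.D]) (List.append_assoc [DyckStep.U] _ _).symm

/-- The word `Z(d) - Z(d+1) - ⋯ Z(d+j-1) -`, which remains of `Z(d+j)` after its prefix of `j`
pluses and the first `Z(d)`. -/
def rightArm (d : ℕ) : ℕ → List DyckStep
  | 0 => []
  | j + 1 => rightArm d j ++ (Z (d + j)).toList ++ [DyckStep.D]

theorem toList_Z_add (d j : ℕ) :
    (Z (d + j)).toList = List.replicate j DyckStep.U ++ (Z d).toList ++ rightArm d j := by
  induction j with
  | zero => simp [rightArm]
  | succ j ih =>
    rw [← Nat.add_assoc, toList_Z_succ, rightArm]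
    nth_rw 1 [ih]
    simp [List.replicate_succ]

/-- The number of runs, in addition to those of the base, that suffices to erase `Z(D)` on top of
a superincreasing stack of height `N - D`. -/
def runBudget (N : ℕ) : ℕ := (Nat.log 2 N + 2) ^ 2

theorem log_add_two_le_runBudget (N : ℕ) : Nat.log 2 N + 2 ≤ runBudget N :=
  Nat.le_self_pow two_ne_zero _

theorem runBudget_add_log_le {D N : ℕ} (hD : D ≠ 0) (h : D * 2 ≤ N) :
    runBudget D + (Nat.log 2 N + 1) ≤ runBudget N := by
  have hlog : Nat.log 2 D + 1 ≤ Nat.log 2 N := by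
    rw [← Nat.log_mul_base one_lt_two hD]
    exact Nat.log_mono_right h
  unfold runBudget
  nlinarith

/-- On top of any base `B` and superincreasing stack `A` within the budget, the word `Z(D)` can be
erased, without the width exceeding `k`, at the expense of at most consolidating the stack. -/
def Absorbs (k D : ℕ) : Prop :=
  ∀ ⦃w : List DyckStep⦄ ⦃B A : List ℕ⦄, Superincreasing A →
    runs B + runBudget (A.length + D) ≤ k → Reachable k w (B ++ A) →
    ∃ A', Consolidates A A' ∧ Reachable k (w ++ (Z D).toList) (B ++ A')

section Absorbs

variable {k D : ℕ} {w : List DyckStep} {B A : List ℕ}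

theorem Absorbs.pop_head (hD : Absorbs k D) (hA : Superincreasing A) (hne : A ≠ [])
    (hk : runs B + runBudget (A.length + D) ≤ k) (h : Reachable k w (B ++ A)) :
    ∃ A', Consolidates A.tail A' ∧
      Reachable k (w ++ (Z D).toList ++ [DyckStep.D]) (B ++ A') := by
  obtain ⟨A', hAA', h'⟩ := hD hA hk h
  have hlen : A'.length = A.length := hAA'.length_eq
  have hne' : A' ≠ [] := List.length_pos_iff.1 (hlen ▸ List.length_pos_iff.2 hne)
  have hruns : runs (B ++ A'.tail) + 1 ≤ k := by
    have htail : A'.tail.length ≤ A.length + D := by rw [List.length_tail]; omega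
    have hrun := (hAA'.superincreasing hA).tail.runs_append_le B htail
    have hbudget := log_add_two_le_runBudget (A.length + D)
    omega
  exact ⟨A'.tail, by simpa only [List.drop_one] using hAA'.drop 1, h'.pop_head hne' hruns⟩

theorem Absorbs.append_Z_succ (hD : Absorbs k D) (hk : runs B + runBudget (D + 1) ≤ k)
    (h : Reachable k w B) : Reachable k (w ++ (Z (D + 1)).toList) B := by
  have hone : Superincreasing (List.range' w.length 1) := .range' _ _
  rw [Nat.add_comm D 1] at hk
  obtain ⟨A₁, hA₁, h₁⟩ := hD hone (by simpa using hk) (h.push_replicate 1)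
  have hlen₁ : A₁.length = 1 := by simpa using hA₁.length_eq
  obtain ⟨A₂, hA₂, h₂⟩ := hD.pop_head (hA₁.superincreasing hone)
    (List.length_pos_iff.1 (by omega)) (by rwa [hlen₁]) h₁
  have hnil : A₂ = [] := List.length_eq_zero_iff.1 (by simp [hA₂.length_eq, hlen₁])
  simpa [toList_Z_succ, hnil] using h₂

theorem Reachable.append_rightArm {d j : ℕ} (hZ : ∀ i < j, Absorbs k (d + i))
    (hA : Superincreasing A) (hj : j ≤ A.length) (hk : runs B + runBudget (A.length + d) ≤ k)
    (h : Reachable k w (B ++ A)) :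
    ∃ A', Consolidates (A.drop j) A' ∧ Reachable k (w ++ rightArm d j) (B ++ A') := by
  induction j with
  | zero => exact ⟨A, .refl A, by simpa [rightArm] using h⟩
  | succ j ih =>
    obtain ⟨A₁, hA₁, h₁⟩ := ih (fun i hi => hZ i (hi.trans j.lt_succ_self)) (by omega)
    have hlen₁ : A₁.length = A.length - j := by rw [hA₁.length_eq, List.length_drop]
    obtain ⟨A₂, hA₂, h₂⟩ := (hZ j j.lt_succ_self).pop_head (hA₁.superincreasing (hA.drop j))
      (List.length_pos_iff.1 (by omega))
      (by rwa [hlen₁, show A.length - j + (d + j) = A.length + d by omega]) h₁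
    have hdrop : Consolidates (A.drop (j + 1)) A₁.tail := by simpa using hA₁.drop 1
    exact ⟨A₂, hdrop.trans hA₂, by simpa [rightArm] using h₂⟩

theorem Reachable.append_Z_of_lt_length (hD : Absorbs k D) (hA : Superincreasing A)
    (hlt : D + 1 < A.length) (hk : runs B + runBudget (A.length + (D + 1)) ≤ k)
    (h : Reachable k w (B ++ A)) : Reachable k (w ++ (Z (D + 1)).toList) (B ++ A) := by
  refine hD.append_Z_succ ?_ h
  have hruns := hA.runs_append_le B (Nat.le_add_right A.length (D + 1))
  have hbudget := runBudget_add_log_le (N := A.length + (D + 1)) (Nat.add_one_ne_zero D) (by omega)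
  omega

theorem Reachable.append_Z_of_length_le (hZ : ∀ i < D, Absorbs k i) (hA : Superincreasing A)
    (hne : A ≠ []) (hle : A.length ≤ D) (hk : runs B + runBudget (A.length + D) ≤ k)
    (h : Reachable k w (B ++ A)) :
    ∃ A', Consolidates A A' ∧ Reachable k (w ++ (Z D).toList) (B ++ A') := by
  have hpos : 0 < A.length := List.length_pos_iff.2 hne
  obtain ⟨d, rfl⟩ := Nat.exists_eq_add_of_le' hle
  set s := A.length with hs
  set A₀ := A ++ List.range' w.length s with hA₀
  have hlen₀ : A₀.length = s + s := by simp [hA₀, ← hs]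
  have hsup₀ : Superincreasing A₀ := hA.append _ _ le_rfl
  have hk₀ : runs B + runBudget (A₀.length + d) ≤ k := by
    rwa [hlen₀, show s + s + d = s + (d + s) by omega]
  obtain ⟨A₁, hA₁, h₁⟩ := hZ d (by omega) hsup₀ hk₀
    (by simpa [hA₀] using h.push_replicate s)
  have hlen₁ : A₁.length = A₀.length := hA₁.length_eq
  obtain ⟨A₂, hA₂, h₂⟩ := h₁.append_rightArm (fun i hi => hZ (d + i) (by omega))
    (hA₁.superincreasing hsup₀) (j := s) (by omega) (by rwa [hlen₁])
  have hinterval : Consolidates (List.range' w.length s) A₂ := by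
    simpa [hA₀, hs] using (hA₁.drop s).trans hA₂
  exact ⟨A₂, .inr hinterval.exists_eq_range', by simpa [toList_Z_add] using h₂⟩

theorem absorbs (k D : ℕ) : Absorbs k D := by
  induction D using Nat.strong_induction_on with
  | _ D IH =>
  intro w B A hA hk h
  cases D with
  | zero => exact ⟨A, .refl A, by simpa [toList_Z_zero] using h⟩
  | succ D =>
    have hD : Absorbs k D := IH D D.lt_succ_self
    obtain hlt | hle := lt_or_ge (D + 1) A.length
    · exact ⟨A, .refl A, h.append_Z_of_lt_length hD hA hlt hk⟩
    obtain rfl | hne := eq_or_ne A []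
    · rw [List.append_nil] at h
      exact ⟨[], .refl [], by simpa using hD.append_Z_succ (by simpa using hk) h⟩
    · exact h.append_Z_of_length_le IH hA hne hle hk

end Absorbs

theorem sq_natLog_add_two_le_two_rpow {n : ℕ} (hn : 2 ≤ n) :
    ((Nat.log 2 n : ℝ) + 2) ^ 2 ≤ 2 ^ (4 * √(Real.logb 2 n)) := by
  have hn' : (2 : ℝ) ≤ n := by exact_mod_cast hn
  have hL : 1 ≤ Real.logb 2 n := by
    rw [Real.le_logb_iff_rpow_le one_lt_two (by linarith), Real.rpow_one]
    exact hn'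
  set x := √(Real.logb 2 n)
  have hx_one : 1 ≤ x := Real.one_le_sqrt.2 hL
  have hx_sq : x ^ 2 = Real.logb 2 n := Real.sq_sqrt (by linarith)
  have hlog : (Nat.log 2 n : ℝ) ≤ x ^ 2 := by
    rw [hx_sq]
    exact_mod_cast Real.natLog_le_logb n 2
  have hbernoulli : x + 1 ≤ 2 ^ x :=
    calc x + 1 = 1 + x * 1 := by ring
      _ ≤ (1 + 1) ^ x := one_add_mul_self_le_rpow_one_add (by norm_num) hx_one
      _ = 2 ^ x := by rw [one_add_one_eq_two]
  calc ((Nat.log 2 n : ℝ) + 2) ^ 2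
      ≤ ((x + 1) ^ 2) ^ 2 := by gcongr; nlinarith
    _ ≤ (((2 : ℝ) ^ x) ^ 2) ^ 2 := by gcongr
    _ = 2 ^ (4 * x) := by
        rw [← pow_mul, mul_comm 4 x, Real.rpow_mul zero_le_two]
        norm_cast

end BracketRepairing

open BracketRepairing in
theorem mainTheorem5_general (n : ℕ) : width (Z n) ≤ (Nat.log 2 n + 2) ^ 2 := by
  obtain ⟨A, hA, h⟩ := absorbs (runBudget n) n (B := []) .nil (by simp [runs_nil]) (.nil _)
  obtain rfl : A = [] := List.length_eq_zero_iff.1 hA.length_eq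
  exact h.width_le

theorem mainTheorem5 :
    ∃ C : ℝ, ∀ n : ℕ, 2 ≤ n →
      (BracketRepairing.width (BracketRepairing.Z n) : ℝ) ≤
        (2 : ℝ) ^ (C * Real.sqrt (Real.logb 2 (n : ℝ))) :=
  ⟨4, fun n hn => le_trans (by exact_mod_cast mainTheorem5_general n)
    (BracketRepairing.sq_natLog_add_two_le_two_rpow hn)⟩
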